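/- Let $k\ge 2$ and $d\ge 2$ be integers, let $0<a<1$, and let $(\eta_n)_{n\ge 0}$ be non-zero complex numbers with $|\eta_n|\le a^{d^n}$ for every $n\ge 0$. Let $F_n:\mathbb C^k\to\mathbb C^k$ be the automorphisms $$F_n(z_1,\dots,z_k)=(\eta_n z_k,\ z_2^d+\eta_n z_1,\ z_3^d+\eta_n z_2,\ \dots,\ z_k^d+\eta_n z_{k-1}),$$ and let $\Omega=\{z\in\mathbb C^k : F_n\circ\cdots\circ F_0(z)\to 0 \text{ as } n\to\infty\}$ be their non-autonomous basin of attraction at the origin. Then: (i) $\Omega$ is a non-empty open connected set. (ii) $\Omega=\bigcup_{j}\Omega_j$ with $\Omega_j\subset\Omega_{j+1}$ and each $\Omega_j$ a domain biholomorphic to the unit ball of $\mathbb C^k$. (iii) The infinitesimal Kobayashi metric of $\Omega$, i.e. $K_\Omega(p,\xi)=\inf\{1/R : R>0,\ f:\Delta\to\Omega \text{ holomorphic},\ f(0)=p,\ f'(0)=R\xi\}$ with $\Delta$ the open unit disc in $\mathbb C$, vanishes for all $p\in\Omega$ and $\xi\in\mathbb C^k$. (iv) There is a plurisubharmonic function $\psi:\mathbb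 C^k\to[\log a,\infty)$ such that $\Omega=\{z\in\mathbb C^k:\psi(z)<0\}$, and $\psi$ is non-constant on $\Omega$. Moreover $\Omega\ne\mathbb C^k$. Consequently $\Omega$ is a Short $\mathbb C^k$, that is, a domain $\Omega\subsetneq\mathbb C^k$ which is an increasing union of domains biholomorphic to the unit ball, whose infinitesimal Kobayashi metric vanishes identically, and which carries a non-constant bounded plurisubharmonic function. -/

import Mathlib

open Set Filter Topology
open scoped ENNReal

noncomputable section

namespace ShortCk

/-- `ℂ^k` with its Euclidean norm. -/
abbrev Cn (k : ℕ) : Type := EuclideanSpace ℂ (Fin k)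

/-- The map `z ↦ (η z_k, z_2^d + η z_1, …, z_k^d + η z_{k-1})` of `ℂ^k`; coordinates are indexed
from `0` to `k - 1`. -/
def shiftMap (k d : ℕ) (η : ℂ) (z : Cn k) : Cn k :=
  WithLp.toLp 2 fun i : Fin k =>
    if i.val = 0 then η * z ⟨k - 1, Nat.sub_lt i.pos one_pos⟩
    else z i ^ d + η * z ⟨i.val - 1, (Nat.sub_le _ _).trans_lt i.isLt⟩

/-- The composition `F_n ∘ ⋯ ∘ F_0`. -/
def compUpTo {X : Type*} (F : ℕ → X → X) : ℕ → X → X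
  | 0 => F 0
  | n + 1 => F (n + 1) ∘ compUpTo F n

/-- The non-autonomous basin of attraction of the sequence `F` at the origin. -/
def basin {k : ℕ} (F : ℕ → Cn k → Cn k) : Set (Cn k) :=
  {z | Tendsto (fun n => compUpTo F n z) atTop (𝓝 0)}

/-- Biholomorphic equivalence of two (open) subsets of `ℂ^k`. -/
def Biholomorphic {k : ℕ} (U V : Set (Cn k)) : Prop :=
  ∃ f g : Cn k → Cn k, DifferentiableOn ℂ f U ∧ DifferentiableOn ℂ g V ∧
    MapsTo f U V ∧ MapsTo g V U ∧ LeftInvOn g f U ∧ RightInvOn g f V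

/-- `Ω` is the union of an increasing sequence of domains, each of which is biholomorphic to the
open unit ball of `ℂ^k`. -/
def IsIncreasingUnionOfBalls {k : ℕ} (Ω : Set (Cn k)) : Prop :=
  ∃ U : ℕ → Set (Cn k), (∀ j, U j ⊆ U (j + 1)) ∧ (∀ j, IsOpen (U j)) ∧
    (∀ j, Biholomorphic (U j) (Metric.ball (0 : Cn k) 1)) ∧ Ω = ⋃ j, U j

/-- The infinitesimal Kobayashi (pseudo-)metric of `Ω` at the point `p` in the direction `ξ`: the
infimum of `1 / R` over all `R > 0` for which some holomorphic map `f` from the open unit disc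
to `Ω` has `f 0 = p` and `f' 0 = R ξ`. -/
def kobayashiMetric {k : ℕ} (Ω : Set (Cn k)) (p ξ : Cn k) : ℝ≥0∞ :=
  sInf {c : ℝ≥0∞ | ∃ (R : ℝ) (f : ℂ → Cn k), 0 < R ∧
    DifferentiableOn ℂ f (Metric.ball 0 1) ∧ MapsTo f (Metric.ball 0 1) Ω ∧
    f 0 = p ∧ deriv f 0 = (R : ℂ) • ξ ∧ c = ENNReal.ofReal (1 / R)}

/-- A real-valued (i.e. nowhere `-∞`) function `u` is plurisubharmonic on the open set `Ω`: it is
upper semicontinuous, and it satisfies the sub-mean value inequality on every closed affine complex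
disc `{z + ζ w : |ζ| ≤ 1}` contained in `Ω`. Since `u z` is finite, the inequality includes that
the mean over the circle is not `-∞`, i.e. that `u` is integrable there. -/
def IsPSHOn {k : ℕ} (u : Cn k → ℝ) (Ω : Set (Cn k)) : Prop :=
  UpperSemicontinuousOn u Ω ∧
    ∀ z w : Cn k, (∀ ζ : ℂ, ‖ζ‖ ≤ 1 → z + ζ • w ∈ Ω) →
      CircleIntegrable (fun ζ : ℂ => u (z + ζ • w)) 0 1 ∧
        u z ≤ Real.circleAverage (fun ζ : ℂ => u (z + ζ • w)) 0 1

/-- A Short `ℂ^k`: a proper subdomain of `ℂ^k` that is an increasing union of domains biholomorphic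
to the ball, whose infinitesimal Kobayashi metric vanishes identically, and which carries a bounded
non-constant plurisubharmonic function (so that it is not biholomorphic to `ℂ^k`). -/
structure IsShortCk {k : ℕ} (Ω : Set (Cn k)) : Prop where
  isOpen : IsOpen Ω
  isConnected : IsConnected Ω
  ne_univ : Ω ≠ univ
  union_of_balls : IsIncreasingUnionOfBalls Ω
  kobayashi_zero : ∀ p ∈ Ω, ∀ ξ : Cn k, kobayashiMetric Ω p ξ = 0
  exists_psh : ∃ u : Cn k → ℝ, IsPSHOn u Ω ∧ (∃ m M : ℝ, ∀ z ∈ Ω, m ≤ u z ∧ u z ≤ M) ∧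
    ∃ z ∈ Ω, ∃ w ∈ Ω, u z ≠ u w

end ShortCk

end

/-!
Write `Φ_n = F_n ∘ ⋯ ∘ F_0`. For large `n` the maps `F_n` contract a fixed ball `B` uniformly, so
`Ω` is the increasing union of the preimages `Φ_n⁻¹(B)`, and `Φ_n → 0` locally uniformly on `Ω`.
Hence `DΦ_n → 0` on `Ω`, and as `Φ_n⁻¹` maps `B` into `Ω`, decreasing the Kobayashi metric, the
metric of `Ω` vanishes.

Since `‖F_{n+1} z‖ ≤ 2 max(‖z‖, a^{d^n})^d`, the plurisubharmonic functions
`d⁻ⁿ log (2 max(‖Φ_n‖, a^{d^n}))` decrease to a plurisubharmonic `ψ` with `Ω = {ψ < 0}` and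
`ψ(0) = log a`. For `a < c < 1` and `N` large, the `N`-th image `2 c^{d^N} e_2` of a point of `Ω` is
so far from `0` that the `d`-th power dominates in all later steps, whence `ψ ≥ log c` there.
-/

namespace ShortCk

open Metric Real MeasureTheory

/-! ### Plurisubharmonic functions -/

section SubmeanValue

variable {c : ℂ} {R : ℝ}

theorem log_norm_le_circleAverage {f : ℂ → ℂ} (hf : AnalyticOnNhd ℂ f (closedBall c |R|))
    (hfc : f c ≠ 0) : log ‖f c‖ ≤ circleAverage (fun ζ => log ‖f ζ‖) c R := by
  rcases eq_or_ne R 0 with rfl | hR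
  · rw [circleAverage_zero]
  rw [hf.circleAverage_log_norm hR hfc]
  refine le_add_of_nonneg_left (finsum_nonneg fun u => ?_)
  by_cases hu : u ∈ closedBall c |R|
  · refine mul_nonneg (mod_cast MeromorphicOn.AnalyticOnNhd.divisor_nonneg hf u) ?_
    rw [← log_abs, abs_mul, abs_inv, abs_norm, ← dist_eq_norm, ← div_eq_mul_inv]
    rcases eq_or_ne c u with rfl | hcu
    · simp
    · exact log_nonneg ((one_le_div (dist_pos.2 hcu)).2 (mem_closedBall'.1 hu))
  · simp [Function.locallyFinsuppWithin.apply_eq_zero_of_notMem _ hu]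

theorem circleIntegrable_posLog_norm {E : Type*} [NormedAddCommGroup E] {f : ℂ → E}
    (hf : ContinuousOn f (sphere c |R|)) : CircleIntegrable (fun ζ => log⁺ ‖f ζ‖) c R :=
  (continuous_posLog.comp_continuousOn hf.norm).circleIntegrable'

theorem posLog_norm_le_circleAverage {E : Type*} [NormedAddCommGroup E] [NormedSpace ℂ E]
    {f : ℂ → E} (hf : AnalyticOnNhd ℂ f (closedBall c |R|)) :
    log⁺ ‖f c‖ ≤ circleAverage (fun ζ => log⁺ ‖f ζ‖) c R := by
  rcases le_total ‖f c‖ 1 with hfc | hfc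
  · rw [(posLog_eq_zero_iff _).2 (by rwa [abs_norm])]
    exact circleAverage_nonneg_of_nonneg fun _ _ => posLog_nonneg
  obtain ⟨g, hg, hgfc⟩ := exists_dual_vector'' ℂ (f c)
  have hgf : AnalyticOnNhd ℂ (fun ζ => g (f ζ)) (closedBall c |R|) :=
    fun ζ hζ => (g.analyticAt _).comp (hf ζ hζ)
  have hgfc' : ‖g (f c)‖ = ‖f c‖ := by simp [hgfc]
  have hle : ∀ ζ, log ‖g (f ζ)‖ ≤ log⁺ ‖f ζ‖ := fun ζ =>
    (le_max_right 0 (log ‖g (f ζ)‖)).trans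
      (posLog_le_posLog (norm_nonneg _) (by simpa using g.le_of_opNorm_le hg (f ζ)))
  calc log⁺ ‖f c‖ = log ‖g (f c)‖ := by rw [hgfc', posLog_eq_log (by rwa [abs_norm])]
    _ ≤ circleAverage (fun ζ => log ‖g (f ζ)‖) c R :=
      log_norm_le_circleAverage hgf (norm_pos_iff.1 (by rw [hgfc']; linarith))
    _ ≤ circleAverage (fun ζ => log⁺ ‖f ζ‖) c R :=
      circleAverage_mono
        (MeromorphicOn.circleIntegrable_log_norm fun ζ hζ =>
          (hgf ζ (sphere_subset_closedBall hζ)).meromorphicAt)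
        (circleIntegrable_posLog_norm (hf.continuousOn.mono sphere_subset_closedBall))
        fun ζ _ => hle ζ

theorem circleIntegrable_and_tendsto_circleAverage_iInf_of_antitone {u : ℕ → ℂ → ℝ}
    (hu : ∀ n, CircleIntegrable (u n) c R) (hanti : ∀ ζ ∈ sphere c |R|, Antitone (u · ζ)) {m : ℝ}
    (hm : ∀ n, ∀ ζ ∈ sphere c |R|, m ≤ u n ζ) :
    CircleIntegrable (fun ζ => ⨅ n, u n ζ) c R ∧
      Tendsto (fun n => circleAverage (u n) c R) atTop
        (𝓝 (circleAverage (fun ζ => ⨅ n, u n ζ) c R)) := by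
  set v : ℕ → ℝ → ℝ := fun n θ => u n (circleMap c R θ)
  have hmem := circleMap_mem_sphere' c R
  have hmeas : ∀ n, AEStronglyMeasurable (v n) (volume.restrict (uIoc 0 (2 * π))) := fun n =>
    (intervalIntegrable_iff.1 (hu n)).aestronglyMeasurable
  have hlim : ∀ θ, Tendsto (v · θ) atTop (𝓝 (⨅ n, v n θ)) := fun θ =>
    tendsto_atTop_ciInf (hanti _ (hmem θ)) ⟨m, forall_mem_range.2 fun n => hm n _ (hmem θ)⟩
  have hbound : ∀ n θ, ‖v n θ‖ ≤ |m| + |v 0 θ| := fun n θ =>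
    (abs_le_max_abs_abs (hm n _ (hmem θ)) (hanti _ (hmem θ) n.zero_le)).trans
      (max_le_add_of_nonneg (abs_nonneg _) (abs_nonneg _))
  have hbound_int : IntervalIntegrable (fun θ => |m| + |v 0 θ|) volume 0 (2 * π) :=
    intervalIntegrable_const.add (hu 0).abs
  refine ⟨hbound_int.mono_fun
      (aestronglyMeasurable_of_tendsto_ae _ hmeas (ae_of_all _ hlim)) (ae_of_all _ fun θ => ?_),
    Tendsto.const_smul (intervalIntegral.tendsto_integral_filter_of_dominated_convergence _
      (Eventually.of_forall hmeas) (Eventually.of_forall fun n => ae_of_all _ fun θ _ => hbound n θ)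
      hbound_int (ae_of_all _ fun θ _ => hlim θ)) _⟩
  exact (le_of_tendsto' (hlim θ).norm fun n => hbound n θ).trans (le_abs_self _)

end SubmeanValue

section IsPSHOn

variable {k : ℕ} {u : Cn k → ℝ} {Ω : Set (Cn k)}

theorem IsPSHOn.mono {Ω' : Set (Cn k)} (hu : IsPSHOn u Ω) (hΩ : Ω' ⊆ Ω) : IsPSHOn u Ω' :=
  ⟨hu.1.mono hΩ, fun z w hzw => hu.2 z w fun ζ hζ => hΩ (hzw ζ hζ)⟩

theorem IsPSHOn.const_add (hu : IsPSHOn u Ω) (b : ℝ) : IsPSHOn (fun z => b + u z) Ω := by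
  refine ⟨(continuous_const_add b).comp_upperSemicontinuousOn hu.1
    (monotone_id.const_add b), fun z w hzw => ?_⟩
  obtain ⟨hint, hle⟩ := hu.2 z w hzw
  refine ⟨(circleIntegrable_const b 0 1).add hint, ?_⟩
  rw [circleAverage_fun_add (circleIntegrable_const b 0 1) hint, circleAverage_const]
  exact add_le_add_right hle b

theorem IsPSHOn.const_mul (hu : IsPSHOn u Ω) {b : ℝ} (hb : 0 ≤ b) :
    IsPSHOn (fun z => b * u z) Ω := by
  refine ⟨(continuous_const_mul b).comp_upperSemicontinuousOn hu.1
    (monotone_id.const_mul hb), fun z w hzw => ?_⟩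
  obtain ⟨hint, hle⟩ := hu.2 z w hzw
  refine ⟨hint.const_smul (a := b), ?_⟩
  simp only [← smul_eq_mul, circleAverage_fun_smul]
  exact smul_le_smul_of_nonneg_left hle hb

theorem isPSHOn_posLog_norm {E : Type*} [NormedAddCommGroup E] [NormedSpace ℂ E]
    [CompleteSpace E] {f : Cn k → E} (hΩ : IsOpen Ω) (hf : DifferentiableOn ℂ f Ω) :
    IsPSHOn (fun z => log⁺ ‖f z‖) Ω := by
  refine ⟨(continuous_posLog.comp_continuousOn hf.continuousOn.norm).upperSemicontinuousOn,
    fun z w hzw => ?_⟩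
  set line : ℂ → Cn k := fun ζ => z + ζ • w
  have hline : Differentiable ℂ line := by fun_prop
  have hdisc : AnalyticOnNhd ℂ (f ∘ line) (closedBall 0 |1|) :=
    ((hf.comp hline.differentiableOn (mapsTo_preimage line Ω)).analyticOnNhd
      (hΩ.preimage hline.continuous)).mono fun ζ hζ => hzw ζ (by simpa using hζ)
  exact ⟨circleIntegrable_posLog_norm (hdisc.continuousOn.mono sphere_subset_closedBall),
    by simpa [line] using posLog_norm_le_circleAverage hdisc⟩

theorem log_max_eq_log_add_posLog {x b : ℝ} (hx : 0 ≤ x) (hb : 0 < b) :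
    log (max x b) = log b + log⁺ (b⁻¹ * x) := by
  rw [posLog_eq_log_max_one (by positivity), ← log_mul hb.ne' (by positivity),
    mul_max_of_nonneg _ _ hb.le, mul_one, mul_inv_cancel_left₀ hb.ne', max_comm]

theorem isPSHOn_log_max_norm {E : Type*} [NormedAddCommGroup E] [NormedSpace ℂ E]
    [CompleteSpace E] {f : Cn k → E} (hΩ : IsOpen Ω) (hf : DifferentiableOn ℂ f Ω) {b : ℝ}
    (hb : 0 < b) : IsPSHOn (fun z => log (max ‖f z‖ b)) Ω := by
  have hpsh := (isPSHOn_posLog_norm hΩ (hf.const_smul (b⁻¹ : ℂ))).const_add (log b)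
  refine (funext fun z => ?_ : (fun z => log (max ‖f z‖ b)) = _) ▸ hpsh
  simp [log_max_eq_log_add_posLog (norm_nonneg _) hb, norm_smul, abs_of_pos hb]

theorem isPSHOn_iInf_of_antitone {u : ℕ → Cn k → ℝ} (hu : ∀ n, IsPSHOn (u n) Ω)
    (hanti : ∀ z ∈ Ω, Antitone (u · z)) {m : ℝ} (hm : ∀ n, ∀ z ∈ Ω, m ≤ u n z) :
    IsPSHOn (fun z => ⨅ n, u n z) Ω := by
  have hbdd : ∀ z ∈ Ω, BddBelow (range (u · z)) := fun z hz =>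
    ⟨m, forall_mem_range.2 fun n => hm n z hz⟩
  refine ⟨upperSemicontinuousOn_ciInf hbdd fun n => (hu n).1, fun z w hzw => ?_⟩
  have hmem : ∀ ζ ∈ sphere (0 : ℂ) |1|, z + ζ • w ∈ Ω := fun ζ hζ =>
    hzw ζ (by simpa using (mem_sphere_zero_iff_norm.1 hζ).le)
  have hz : z ∈ Ω := by simpa using hzw 0 (by simp)
  obtain ⟨hint, hlim⟩ := circleIntegrable_and_tendsto_circleAverage_iInf_of_antitone
    (fun n => ((hu n).2 z w hzw).1) (fun ζ hζ => hanti _ (hmem ζ hζ)) fun n ζ hζ =>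
      hm n _ (hmem ζ hζ)
  exact ⟨hint, ge_of_tendsto' hlim fun n => (ciInf_le (hbdd z hz) n).trans ((hu n).2 z w hzw).2⟩

end IsPSHOn

/-! ### Holomorphic automorphisms and the Kobayashi metric -/

/-- Biholomorphic self-maps of a complex normed space: entire maps with an entire two-sided
inverse. -/
def IsAutomorphism {E : Type*} [NormedAddCommGroup E] [NormedSpace ℂ E] (f : E → E) : Prop :=
  Differentiable ℂ f ∧
    ∃ g, Differentiable ℂ g ∧ Function.LeftInverse g f ∧ Function.RightInverse g f

namespace IsAutomorphism

section

variable {E : Type*} [NormedAddCommGroup E] [NormedSpace ℂ E] {f g : E → E}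

theorem differentiable (hf : IsAutomorphism f) : Differentiable ℂ f := hf.1

theorem surjective (hf : IsAutomorphism f) : Function.Surjective f :=
  let ⟨_, _, _, hright⟩ := hf.2
  hright.surjective

theorem comp (hg : IsAutomorphism g) (hf : IsAutomorphism f) : IsAutomorphism (g ∘ f) := by
  obtain ⟨hf, f', hf', hf'f, hff'⟩ := hf
  obtain ⟨hg, g', hg', hg'g, hgg'⟩ := hg
  exact ⟨hg.comp hf, f' ∘ g', hf'.comp hg', hg'g.comp hf'f, hgg'.comp hff'⟩

theorem const_smul (hf : IsAutomorphism f) {b : ℂ} (hb : b ≠ 0) :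
    IsAutomorphism (fun z => b • f z) := by
  obtain ⟨hf, g, hg, hgf, hfg⟩ := hf
  refine ⟨hf.const_smul b, fun w => g (b⁻¹ • w), hg.comp (differentiable_id.const_smul b⁻¹),
    fun z => ?_, fun w => ?_⟩
  · simp only [inv_smul_smul₀ hb, hgf z]
  · simp only [hfg (b⁻¹ • w), smul_inv_smul₀ hb]

theorem isConnected_preimage (hf : IsAutomorphism f) {V : Set E} (hV : IsConnected V) :
    IsConnected (f ⁻¹' V) := by
  obtain ⟨-, g, hg, hgf, hfg⟩ := hf
  rw [← image_eq_preimage_of_inverse hfg hgf]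
  exact hV.image g hg.continuous.continuousOn

theorem compUpTo {F : ℕ → E → E} (hF : ∀ n, IsAutomorphism (F n)) :
    ∀ n, IsAutomorphism (compUpTo F n)
  | 0 => hF 0
  | n + 1 => (hF (n + 1)).comp (IsAutomorphism.compUpTo hF n)

end

variable {k : ℕ} {f : Cn k → Cn k}

theorem biholomorphic_preimage (hf : IsAutomorphism f) (V : Set (Cn k)) :
    Biholomorphic (f ⁻¹' V) V := by
  obtain ⟨hf, g, hg, hgf, hfg⟩ := hf
  refine ⟨f, g, hf.differentiableOn, hg.differentiableOn, mapsTo_preimage f V, fun w hw => ?_,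
    hgf.leftInvOn _, hfg.rightInvOn _⟩
  rwa [mem_preimage, hfg]

theorem biholomorphic_preimage_ball (hf : IsAutomorphism f) {r : ℝ} (hr : 0 < r) :
    Biholomorphic (f ⁻¹' ball 0 r) (ball 0 1) := by
  have hpre : f ⁻¹' ball 0 r = (fun z => (r⁻¹ : ℂ) • f z) ⁻¹' ball 0 1 := by
    ext z
    simp only [mem_preimage, mem_ball_zero_iff, norm_smul, norm_inv, Complex.norm_real,
      norm_of_nonneg hr.le, inv_mul_lt_one₀ hr]
  rw [hpre]
  exact (hf.const_smul (by simpa using hr.ne')).biholomorphic_preimage _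

end IsAutomorphism

section KobayashiMetric

variable {k l : ℕ} {Ω : Set (Cn k)}

theorem kobayashiMetric_le_of_mapsTo {U : Set (Cn l)} (hU : IsOpen U) {g : Cn l → Cn k}
    (hg : DifferentiableOn ℂ g U) (hmaps : MapsTo g U Ω) {q : Cn l} (hq : q ∈ U) (v : Cn l) :
    kobayashiMetric Ω (g q) (fderiv ℂ g q v) ≤ kobayashiMetric U q v := by
  refine sInf_le_sInf ?_
  rintro _ ⟨R, f, hR, hf, hfU, rfl, hf0, rfl⟩
  refine ⟨R, g ∘ f, hR, hg.comp hf hfU, hmaps.comp hfU, rfl, ?_, rfl⟩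
  have hfd : DifferentiableAt ℂ f 0 := hf.differentiableAt (ball_mem_nhds 0 one_pos)
  rw [fderiv_comp_deriv _ (hg.differentiableAt (hU.mem_nhds hq)) hfd, hf0, map_smul]

theorem kobayashiMetric_le_of_ball_subset {p : Cn k} {s : ℝ} (hs : 0 < s) (hball : ball p s ⊆ Ω)
    (ξ : Cn k) : kobayashiMetric Ω p ξ ≤ ENNReal.ofReal (‖ξ‖ / s) := by
  have hlim : Tendsto ENNReal.ofReal (𝓝[>] (‖ξ‖ / s)) (𝓝 (ENNReal.ofReal (‖ξ‖ / s))) :=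
    ENNReal.continuous_ofReal.continuousWithinAt
  refine ge_of_tendsto hlim (eventually_mem_nhdsWithin.mono fun t (ht : ‖ξ‖ / s < t) => ?_)
  have ht0 : 0 < t := (div_nonneg (norm_nonneg ξ) hs.le).trans_lt ht
  refine sInf_le ⟨t⁻¹, fun ζ => p + ζ • (t⁻¹ : ℂ) • ξ, inv_pos.2 ht0,
    Differentiable.differentiableOn (by fun_prop), fun ζ hζ => hball ?_, by simp, ?_, by simp⟩
  · rw [div_lt_iff₀ hs, ← inv_mul_lt_iff₀ ht0] at ht
    rw [mem_ball_iff_norm, add_sub_cancel_left, norm_smul, norm_smul, norm_inv, Complex.norm_real,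
      norm_of_nonneg ht0.le]
    exact (mul_le_of_le_one_left (by positivity) (mem_ball_zero_iff.1 hζ).le).trans_lt ht
  · simpa using ((hasDerivAt_id (0 : ℂ)).smul_const ((t⁻¹ : ℂ) • ξ)).const_add p |>.deriv

theorem IsAutomorphism.kobayashiMetric_le {f : Cn k → Cn k} (hf : IsAutomorphism f)
    {V : Set (Cn k)} (hV : IsOpen V) (hΩ : f ⁻¹' V ⊆ Ω) {p : Cn k} (hp : f p ∈ V) (ξ : Cn k) :
    kobayashiMetric Ω p ξ ≤ kobayashiMetric V (f p) (fderiv ℂ f p ξ) := by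
  obtain ⟨hf, g, hg, hgf, hfg⟩ := hf
  have hmaps : MapsTo g V Ω := fun w hw => hΩ (by rwa [mem_preimage, hfg])
  have hchain : fderiv ℂ g (f p) (fderiv ℂ f p ξ) = ξ := by
    rw [← ContinuousLinearMap.comp_apply, ← fderiv_comp p (hg _) (hf p), hgf.comp_eq_id, fderiv_id,
      ContinuousLinearMap.id_apply]
  simpa only [hchain, hgf p] using
    kobayashiMetric_le_of_mapsTo hV hg.differentiableOn hmaps hp (fderiv ℂ f p ξ)

end KobayashiMetric

/-! ### Basins of eventually contracting sequences -/

theorem compUpTo_mem_of_mapsTo {X : Type*} {F : ℕ → X → X} {S : Set X}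
    (hF : ∀ n, MapsTo (F n) S S) {x : X} (hx : x ∈ S) : ∀ n, compUpTo F n x ∈ S
  | 0 => hF 0 hx
  | n + 1 => hF (n + 1) (compUpTo_mem_of_mapsTo hF hx n)

/-- From the index `N` on, the maps `F n` contract the ball of radius `r` about the origin towards
the origin, by a factor `c < 1` that does not depend on `n`. -/
structure EventuallyContracting {E : Type*} [SeminormedAddCommGroup E] (F : ℕ → E → E) (N : ℕ)
    (r c : ℝ) : Prop where
  radius_pos : 0 < r
  rate_nonneg : 0 ≤ c
  rate_lt_one : c < 1
  norm_le : ∀ n ≥ N, ∀ w, ‖w‖ < r → ‖F n w‖ ≤ c * ‖w‖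

namespace EventuallyContracting

section

variable {E : Type*} [SeminormedAddCommGroup E] {F : ℕ → E → E} {N n : ℕ} {r c : ℝ} {z : E}

theorem norm_compUpTo_add_le (h : EventuallyContracting F N r c) (hn : N ≤ n)
    (hz : ‖compUpTo F n z‖ < r) : ∀ j, ‖compUpTo F (n + j) z‖ ≤ c ^ j * ‖compUpTo F n z‖
  | 0 => by simp
  | j + 1 => by
    have ih := h.norm_compUpTo_add_le hn hz j
    have hlt : ‖compUpTo F (n + j) z‖ < r := ih.trans_lt <|
      (mul_le_of_le_one_left (norm_nonneg _)
        (pow_le_one₀ h.rate_nonneg h.rate_lt_one.le)).trans_lt hz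
    calc ‖F (n + j + 1) (compUpTo F (n + j) z)‖
        ≤ c * ‖compUpTo F (n + j) z‖ := h.norm_le _ (by lia) _ hlt
      _ ≤ c * (c ^ j * ‖compUpTo F n z‖) := mul_le_mul_of_nonneg_left ih h.rate_nonneg
      _ = c ^ (j + 1) * ‖compUpTo F n z‖ := by ring

theorem monotone_preimage_ball (h : EventuallyContracting F N r c) :
    Monotone fun j => compUpTo F (N + j) ⁻¹' ball 0 r := by
  refine monotone_nat_of_le_succ fun j z hz => ?_
  rw [mem_preimage, mem_ball_zero_iff] at hz ⊢
  calc ‖compUpTo F (N + j + 1) z‖ ≤ c ^ 1 * ‖compUpTo F (N + j) z‖ :=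
        h.norm_compUpTo_add_le (by lia) hz 1
    _ ≤ ‖compUpTo F (N + j) z‖ :=
        mul_le_of_le_one_left (norm_nonneg _) (by simpa using h.rate_lt_one.le)
    _ < r := hz

theorem tendstoUniformlyOn_preimage_ball (h : EventuallyContracting F N r c) (hn : N ≤ n) :
    TendstoUniformlyOn (compUpTo F) 0 atTop (compUpTo F n ⁻¹' ball 0 r) := by
  refine Metric.tendstoUniformlyOn_iff.2 fun ε hε => ?_
  have hlim : Tendsto (fun j => c ^ (j - n) * r) atTop (𝓝 0) := by
    simpa using ((tendsto_pow_atTop_nhds_zero_of_lt_one h.rate_nonneg h.rate_lt_one).comp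
      (tendsto_sub_atTop_nat n)).mul_const r
  filter_upwards [hlim.eventually_lt_const hε, eventually_ge_atTop n] with j hjε hj z hz
  rw [mem_preimage, mem_ball_zero_iff] at hz
  rw [Pi.zero_apply, dist_zero_left]
  calc ‖compUpTo F j z‖ ≤ c ^ (j - n) * ‖compUpTo F n z‖ := by
        simpa only [Nat.add_sub_cancel' hj] using h.norm_compUpTo_add_le hn hz (j - n)
    _ ≤ c ^ (j - n) * r := mul_le_mul_of_nonneg_left hz.le (pow_nonneg h.rate_nonneg _)
    _ < ε := hjε

end

variable {k N : ℕ} {F : ℕ → Cn k → Cn k} {r c : ℝ}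

theorem basin_eq_iUnion (h : EventuallyContracting F N r c) :
    basin F = ⋃ j, compUpTo F (N + j) ⁻¹' ball 0 r := by
  ext z
  rw [mem_iUnion]
  refine ⟨fun hz => ?_, fun ⟨j, hz⟩ =>
    (h.tendstoUniformlyOn_preimage_ball (by lia)).tendsto_at hz⟩
  obtain ⟨j, hj⟩ := eventually_atTop.1 (hz.eventually_mem (ball_mem_nhds 0 h.radius_pos))
  exact ⟨j, hj _ (by lia)⟩

theorem isOpen_basin (h : EventuallyContracting F N r c) (hF : ∀ n, IsAutomorphism (F n)) :
    IsOpen (basin F) := by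
  rw [h.basin_eq_iUnion]
  exact isOpen_iUnion fun j =>
    isOpen_ball.preimage (IsAutomorphism.compUpTo hF _).differentiable.continuous

theorem isConnected_basin (h : EventuallyContracting F N r c) (hF : ∀ n, IsAutomorphism (F n)) :
    IsConnected (basin F) := by
  have hconn : ∀ j, IsConnected (compUpTo F (N + j) ⁻¹' ball 0 r) := fun j =>
    (IsAutomorphism.compUpTo hF _).isConnected_preimage
      ((convex_ball 0 r).isConnected (nonempty_ball.2 h.radius_pos))
  obtain ⟨z, hz⟩ := (hconn 0).nonempty
  have hz' : ∀ j, z ∈ compUpTo F (N + j) ⁻¹' ball 0 r := fun j =>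
    h.monotone_preimage_ball j.zero_le hz
  rw [h.basin_eq_iUnion]
  exact ⟨⟨z, mem_iUnion.2 ⟨0, hz⟩⟩,
    isPreconnected_iUnion ⟨z, mem_iInter.2 hz'⟩ fun j => (hconn j).isPreconnected⟩

theorem isIncreasingUnionOfBalls_basin (h : EventuallyContracting F N r c)
    (hF : ∀ n, IsAutomorphism (F n)) : IsIncreasingUnionOfBalls (basin F) :=
  have hΦ := IsAutomorphism.compUpTo hF
  ⟨fun j => compUpTo F (N + j) ⁻¹' ball 0 r, fun j => h.monotone_preimage_ball j.le_succ,
    fun _ => isOpen_ball.preimage (hΦ _).differentiable.continuous,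
    fun _ => (hΦ _).biholomorphic_preimage_ball h.radius_pos, h.basin_eq_iUnion⟩

theorem tendstoLocallyUniformlyOn_basin (h : EventuallyContracting F N r c)
    (hF : ∀ n, IsAutomorphism (F n)) :
    TendstoLocallyUniformlyOn (compUpTo F) 0 atTop (basin F) := by
  rw [h.basin_eq_iUnion]
  exact tendstoLocallyUniformlyOn_iUnion
    (fun _ => isOpen_ball.preimage (IsAutomorphism.compUpTo hF _).differentiable.continuous)
    fun j => (h.tendstoUniformlyOn_preimage_ball (by lia)).tendstoLocallyUniformlyOn

theorem tendsto_fderiv_compUpTo (h : EventuallyContracting F N r c)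
    (hF : ∀ n, IsAutomorphism (F n)) {p : Cn k} (hp : p ∈ basin F) (ξ : Cn k) :
    Tendsto (fun n => fderiv ℂ (compUpTo F n) p ξ) atTop (𝓝 0) := by
  set line : ℂ → Cn k := fun ζ => p + ζ • ξ with hline
  have hline_diff : Differentiable ℂ line := by fun_prop
  have hdiff : ∀ n, Differentiable ℂ (compUpTo F n) := fun n =>
    (IsAutomorphism.compUpTo hF n).differentiable
  have hloc := ((h.tendstoLocallyUniformlyOn_basin hF).comp line (mapsTo_preimage _ _)
    hline_diff.continuous.continuousOn).deriv
      (Eventually.of_forall fun n => ((hdiff n).comp hline_diff).differentiableOn)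
      ((h.isOpen_basin hF).preimage hline_diff.continuous)
  have hderiv : ∀ n, deriv (compUpTo F n ∘ line) 0 = fderiv ℂ (compUpTo F n) p ξ := by
    intro n
    have hξ : deriv line 0 = ξ :=
      (((hasDerivAt_id (0 : ℂ)).smul_const ξ).const_add p).deriv.trans (one_smul ℂ ξ)
    rw [fderiv_comp_deriv _ (hdiff n _) (hline_diff 0), hξ]
    simp [hline]
  have h0 : (0 : ℂ) ∈ line ⁻¹' basin F := by simpa [hline] using hp
  simpa [Function.comp_def, ← hderiv] using hloc.tendsto_at h0

theorem kobayashiMetric_basin (h : EventuallyContracting F N r c)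
    (hF : ∀ n, IsAutomorphism (F n)) {p : Cn k} (hp : p ∈ basin F) (ξ : Cn k) :
    kobayashiMetric (basin F) p ξ = 0 := by
  have hlim : Tendsto (fun n => ENNReal.ofReal (‖fderiv ℂ (compUpTo F n) p ξ‖ / (r / 2))) atTop
      (𝓝 0) := by
    simpa using ENNReal.tendsto_ofReal ((h.tendsto_fderiv_compUpTo hF hp ξ).norm.div_const (r / 2))
  refine le_antisymm (ge_of_tendsto hlim ?_) zero_le
  have hr := half_pos h.radius_pos
  filter_upwards [hp.eventually_mem (ball_mem_nhds 0 hr), eventually_ge_atTop N] with n hn hNn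
  obtain ⟨j, rfl⟩ := Nat.exists_eq_add_of_le hNn
  have hpre : compUpTo F (N + j) ⁻¹' ball 0 r ⊆ basin F :=
    h.basin_eq_iUnion ▸ subset_iUnion (fun j => compUpTo F (N + j) ⁻¹' ball 0 r) j
  have hsub : ball (compUpTo F (N + j) p) (r / 2) ⊆ ball 0 r :=
    ball_subset_ball' (by linarith [mem_ball.1 hn])
  exact ((IsAutomorphism.compUpTo hF _).kobayashiMetric_le isOpen_ball hpre
    (hsub (mem_ball_self hr)) ξ).trans (kobayashiMetric_le_of_ball_subset hr hsub _)

end EventuallyContracting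

/-! ### The Green-type potential of a superattracting sequence -/

theorem tendsto_pow_pow_atTop {a : ℝ} {d : ℕ} (ha0 : 0 ≤ a) (ha1 : a < 1) (hd : 1 < d) :
    Tendsto (fun n => a ^ d ^ n) atTop (𝓝 0) :=
  (tendsto_pow_atTop_nhds_zero_of_lt_one ha0 ha1).comp (tendsto_pow_atTop_atTop_of_one_lt hd)

theorem pow_pow_succ_le_max_pow {a : ℝ} {d n : ℕ} (ha : 0 ≤ a) (x : ℝ) :
    a ^ d ^ (n + 1) ≤ max x (a ^ d ^ n) ^ d := by
  rw [pow_succ, pow_mul]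
  exact pow_le_pow_left₀ (by positivity) (le_max_right _ _) d

/-- Sequences of maps that are, up to perturbations whose size `a ^ d ^ n` decays doubly
exponentially, superattracting of order `d` at the origin, uniformly on the whole space. -/
structure IsSuperattracting {E : Type*} [NormedAddCommGroup E] (F : ℕ → E → E) (d : ℕ) (a : ℝ) :
    Prop where
  two_le : 2 ≤ d
  pos : 0 < a
  lt_one : a < 1
  norm_le : ∀ n z, ‖F n z‖ ≤ ‖z‖ ^ d + a ^ d ^ n * ‖z‖

/-- The functions `d⁻ⁿ log (2 max (‖F_n ∘ ⋯ ∘ F_0‖, a ^ d ^ n))`, which decrease to the potential of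
the basin. The truncation at `a ^ d ^ n` keeps them finite on the zeros of the composition; the
factor `2` makes the sequence decreasing. -/
noncomputable def truncatedPotential {E : Type*} [NormedAddCommGroup E] (F : ℕ → E → E) (d : ℕ)
    (a : ℝ) (n : ℕ) (z : E) : ℝ :=
  ((d : ℝ) ^ n)⁻¹ * log (2 * max ‖compUpTo F n z‖ (a ^ d ^ n))

/-- The function `ψ = inf_n ψ_n`, with `ψ_n` the truncated potentials, whose negative values cut out
the basin of a superattracting sequence. -/
noncomputable def potential {E : Type*} [NormedAddCommGroup E] (F : ℕ → E → E) (d : ℕ) (a : ℝ)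
    (z : E) : ℝ :=
  ⨅ n, truncatedPotential F d a n z

section TruncatedPotential

variable {E : Type*} [NormedAddCommGroup E] {F : ℕ → E → E} {d n : ℕ} {a c : ℝ} {z : E}

theorem two_mul_max_pow_pos (ha : 0 < a) (x : ℝ) : 0 < 2 * max x (a ^ d ^ n) :=
  mul_pos two_pos (lt_max_of_lt_right (by positivity))

theorem truncatedPotential_le_log_iff (hd : d ≠ 0) (ha : 0 < a) (hc : 0 < c) :
    truncatedPotential F d a n z ≤ log c ↔
      2 * max ‖compUpTo F n z‖ (a ^ d ^ n) ≤ c ^ d ^ n := by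
  rw [truncatedPotential, inv_mul_le_iff₀ (by positivity), ← Nat.cast_pow, ← log_pow,
    log_le_log_iff (two_mul_max_pow_pos ha _) (by positivity)]

theorem log_le_truncatedPotential_iff (hd : d ≠ 0) (ha : 0 < a) (hc : 0 < c) :
    log c ≤ truncatedPotential F d a n z ↔
      c ^ d ^ n ≤ 2 * max ‖compUpTo F n z‖ (a ^ d ^ n) := by
  rw [truncatedPotential, le_inv_mul_iff₀ (by positivity), ← Nat.cast_pow, ← log_pow,
    log_le_log_iff (by positivity) (two_mul_max_pow_pos ha _)]

theorem log_le_truncatedPotential (hd : d ≠ 0) (ha : 0 < a) :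
    log a ≤ truncatedPotential F d a n z := by
  rw [log_le_truncatedPotential_iff hd ha ha]
  exact (le_max_right _ _).trans (le_mul_of_one_le_left (by positivity) one_le_two)

theorem isPSHOn_truncatedPotential {k : ℕ} {F : ℕ → Cn k → Cn k}
    (hF : Differentiable ℂ (compUpTo F n)) (ha : 0 < a) :
    IsPSHOn (truncatedPotential F d a n) univ := by
  have hpsh := ((isPSHOn_log_max_norm isOpen_univ hF.differentiableOn
    (pow_pos ha (d ^ n))).const_add (log 2)).const_mul (b := ((d : ℝ) ^ n)⁻¹) (by positivity)
  refine (funext fun z => ?_ : truncatedPotential F d a n = _) ▸ hpsh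
  rw [truncatedPotential, log_mul two_ne_zero (lt_max_of_lt_right (by positivity)).ne']

end TruncatedPotential

namespace IsSuperattracting

section

variable {E : Type*} [NormedAddCommGroup E] {F : ℕ → E → E} {d : ℕ} {a : ℝ} {z : E}

theorem ne_zero (h : IsSuperattracting F d a) : d ≠ 0 := by have := h.two_le; lia

theorem tendsto_pow_pow (h : IsSuperattracting F d a) : Tendsto (fun n => a ^ d ^ n) atTop (𝓝 0) :=
  tendsto_pow_pow_atTop h.pos.le h.lt_one h.two_le

theorem compUpTo_zero (h : IsSuperattracting F d a) (n : ℕ) : compUpTo F n 0 = 0 := by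
  have hfix : ∀ n, MapsTo (F n) {0} {0} := fun n z hz => by
    rw [mem_singleton_iff] at hz ⊢
    simpa [hz, h.ne_zero] using h.norm_le n z
  exact compUpTo_mem_of_mapsTo hfix rfl n

theorem eventually_eventuallyContracting (h : IsSuperattracting F d a) :
    ∀ᶠ N in atTop, EventuallyContracting F N (1 / 4) (1 / 2) := by
  filter_upwards [h.tendsto_pow_pow.eventually_le_const (by norm_num : (0 : ℝ) < 1 / 4)] with N hN
  refine ⟨by norm_num, by norm_num, by norm_num, fun n hn w hw => ?_⟩
  have han : a ^ d ^ n ≤ 1 / 4 :=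
    (pow_le_pow_of_le_one h.pos.le h.lt_one.le (Nat.pow_le_pow_right h.ne_zero.pos hn)).trans hN
  have hwd : ‖w‖ ^ d ≤ ‖w‖ ^ 2 := pow_le_pow_of_le_one (norm_nonneg _) (by linarith) h.two_le
  calc ‖F n w‖ ≤ ‖w‖ ^ d + a ^ d ^ n * ‖w‖ := h.norm_le n w
    _ ≤ ‖w‖ ^ 2 + 1 / 4 * ‖w‖ := by gcongr
    _ = (‖w‖ + 1 / 4) * ‖w‖ := by ring
    _ ≤ 1 / 2 * ‖w‖ := by gcongr; linarith

theorem norm_le_two_mul_pow (h : IsSuperattracting F d a) (n : ℕ) (z : E) :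
    ‖F (n + 1) z‖ ≤ 2 * max ‖z‖ (a ^ d ^ n) ^ d := by
  set M := max ‖z‖ (a ^ d ^ n)
  have hzM : ‖z‖ ^ d ≤ M ^ d := by gcongr; exact le_max_left _ _
  have haM : a ^ d ^ (n + 1) ≤ M ^ d := pow_pow_succ_le_max_pow h.pos.le _
  have hlin : a ^ d ^ (n + 1) * ‖z‖ ≤ M ^ d := by
    rcases le_total ‖z‖ 1 with hz | hz
    · exact (mul_le_of_le_one_right (pow_nonneg h.pos.le _) hz).trans haM
    · calc a ^ d ^ (n + 1) * ‖z‖ ≤ ‖z‖ :=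
            mul_le_of_le_one_left (norm_nonneg z) (pow_le_one₀ h.pos.le h.lt_one.le)
        _ ≤ ‖z‖ ^ d := le_self_pow₀ hz h.ne_zero
        _ ≤ M ^ d := hzM
  linarith [h.norm_le (n + 1) z]

theorem antitone_truncatedPotential (h : IsSuperattracting F d a) (z : E) :
    Antitone (truncatedPotential F d a · z) := by
  refine antitone_nat_of_succ_le fun n => ?_
  set M := max ‖compUpTo F n z‖ (a ^ d ^ n) with hM
  have ha := h.pos
  have hMpos : 0 < M := lt_max_of_lt_right (by positivity)
  have haM : a ^ d ^ (n + 1) ≤ M ^ d := pow_pow_succ_le_max_pow ha.le _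
  have hmax : 2 * max ‖compUpTo F (n + 1) z‖ (a ^ d ^ (n + 1)) ≤ (2 * M) ^ d :=
    calc 2 * max ‖compUpTo F (n + 1) z‖ (a ^ d ^ (n + 1))
        ≤ 2 * (2 * M ^ d) := by
          gcongr
          exact max_le (h.norm_le_two_mul_pow n _) (by linarith [pow_pos hMpos d])
      _ = 2 ^ 2 * M ^ d := by ring
      _ ≤ 2 ^ d * M ^ d := by gcongr; exacts [one_le_two, h.two_le]
      _ = (2 * M) ^ d := (mul_pow _ _ _).symm
  have hd : (d : ℝ) ≠ 0 := Nat.cast_ne_zero.2 h.ne_zero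
  calc truncatedPotential F d a (n + 1) z
      ≤ ((d : ℝ) ^ (n + 1))⁻¹ * log ((2 * M) ^ d) := by
        rw [truncatedPotential]
        gcongr
    _ = truncatedPotential F d a n z := by
        rw [log_pow, truncatedPotential, ← hM, pow_succ]
        field_simp

theorem bddBelow_truncatedPotential (h : IsSuperattracting F d a) (z : E) :
    BddBelow (range (truncatedPotential F d a · z)) :=
  ⟨log a, forall_mem_range.2 fun _ => log_le_truncatedPotential h.ne_zero h.pos⟩

theorem log_le_potential (h : IsSuperattracting F d a) (z : E) : log a ≤ potential F d a z :=
  le_ciInf fun _ => log_le_truncatedPotential h.ne_zero h.pos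

theorem tendsto_truncatedPotential (h : IsSuperattracting F d a) (z : E) :
    Tendsto (truncatedPotential F d a · z) atTop (𝓝 (potential F d a z)) :=
  tendsto_atTop_ciInf (h.antitone_truncatedPotential z) (h.bddBelow_truncatedPotential z)

theorem log_le_potential_of_eventually_pow_le (h : IsSuperattracting F d a) {c : ℝ} (hc : 0 < c)
    (hz : ∀ᶠ n in atTop, c ^ d ^ n ≤ ‖compUpTo F n z‖) : log c ≤ potential F d a z := by
  refine ge_of_tendsto (h.tendsto_truncatedPotential z) (hz.mono fun n hn => ?_)
  rw [log_le_truncatedPotential_iff h.ne_zero h.pos hc]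
  linarith [le_max_left ‖compUpTo F n z‖ (a ^ d ^ n), norm_nonneg (compUpTo F n z)]

theorem potential_zero (h : IsSuperattracting F d a) : potential F d a 0 = log a := by
  refine tendsto_nhds_unique (h.tendsto_truncatedPotential 0) ?_
  have hd : (d : ℝ) ≠ 0 := Nat.cast_ne_zero.2 h.ne_zero
  have heq : ∀ n, truncatedPotential F d a n 0 = ((d : ℝ) ^ n)⁻¹ * log 2 + log a := fun n => by
    have hpow : 0 < a ^ d ^ n := pow_pos h.pos _
    rw [truncatedPotential, h.compUpTo_zero, norm_zero, max_eq_right hpow.le,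
      log_mul two_ne_zero hpow.ne', log_pow, Nat.cast_pow]
    field_simp
  have hlim : Tendsto (fun n : ℕ => ((d : ℝ) ^ n)⁻¹) atTop (𝓝 0) :=
    (tendsto_pow_atTop_atTop_of_one_lt (mod_cast h.two_le)).inv_tendsto_atTop
  simpa only [heq, zero_mul, zero_add] using (hlim.mul_const (log 2)).add_const (log a)

theorem tendsto_compUpTo_iff_potential_neg (h : IsSuperattracting F d a) :
    Tendsto (fun n => compUpTo F n z) atTop (𝓝 0) ↔ potential F d a z < 0 := by
  refine ⟨fun hz => ?_, fun hz => ?_⟩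
  · have hmax : Tendsto (fun n => 2 * max ‖compUpTo F n z‖ (a ^ d ^ n)) atTop (𝓝 0) := by
      simpa using (hz.norm.max h.tendsto_pow_pow).const_mul 2
    obtain ⟨n, hn⟩ := (hmax.eventually_lt_const one_pos).exists
    refine (ciInf_le (h.bddBelow_truncatedPotential z) n).trans_lt ?_
    rw [← log_one, ← not_le, log_le_truncatedPotential_iff h.ne_zero h.pos one_pos, one_pow]
    exact hn.not_ge
  · obtain ⟨b, hzb, hb⟩ := exists_between hz
    have hlim := tendsto_pow_pow_atTop (exp_pos b).le (exp_lt_one_iff.2 hb) h.two_le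
    refine squeeze_zero_norm' ?_ hlim
    filter_upwards [(h.tendsto_truncatedPotential z).eventually_le_const hzb] with n hn
    rw [← log_exp b, truncatedPotential_le_log_iff h.ne_zero h.pos (exp_pos b)] at hn
    linarith [le_max_left ‖compUpTo F n z‖ (a ^ d ^ n), norm_nonneg (compUpTo F n z)]

end

variable {k d : ℕ} {F : ℕ → Cn k → Cn k} {a : ℝ}

theorem basin_eq_setOf_potential_neg (h : IsSuperattracting F d a) :
    basin F = {z | potential F d a z < 0} :=
  ext fun _ => h.tendsto_compUpTo_iff_potential_neg

theorem zero_mem_basin (h : IsSuperattracting F d a) : 0 ∈ basin F :=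
  tendsto_const_nhds.congr fun n => (h.compUpTo_zero n).symm

theorem isPSHOn_potential (h : IsSuperattracting F d a) (hF : ∀ n, IsAutomorphism (F n)) :
    IsPSHOn (potential F d a) univ :=
  isPSHOn_iInf_of_antitone
    (fun n => isPSHOn_truncatedPotential (IsAutomorphism.compUpTo hF n).differentiable h.pos)
    (fun z _ => h.antitone_truncatedPotential z)
    fun _ _ _ => log_le_truncatedPotential h.ne_zero h.pos

end IsSuperattracting

/-! ### The shift maps -/

theorem norm_le_pow_of_forall_norm_le_pow {𝕜 ι : Type*} [RCLike 𝕜] [Fintype ι]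
    {z w : EuclideanSpace 𝕜 ι} {d : ℕ} (hd : d ≠ 0) (h : ∀ i, ‖w i‖ ≤ ‖z i‖ ^ d) :
    ‖w‖ ≤ ‖z‖ ^ d := by
  obtain ⟨e, rfl⟩ := Nat.exists_eq_succ_of_ne_zero hd
  have hcoord : ∀ i, ‖w i‖ ≤ ‖z‖ ^ e * ‖z i‖ := fun i =>
    calc ‖w i‖ ≤ ‖z i‖ ^ e * ‖z i‖ := by simpa only [pow_succ] using h i
      _ ≤ ‖z‖ ^ e * ‖z i‖ := by gcongr; exact PiLp.norm_apply_le z i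
  refine (pow_le_pow_iff_left₀ (norm_nonneg w) (by positivity) two_ne_zero).1 ?_
  calc ‖w‖ ^ 2 = ∑ i, ‖w i‖ ^ 2 := EuclideanSpace.norm_sq_eq w
    _ ≤ ∑ i, (‖z‖ ^ e * ‖z i‖) ^ 2 := by gcongr with i; exact hcoord i
    _ = (‖z‖ ^ (e + 1)) ^ 2 := by
      simp only [mul_pow, ← Finset.mul_sum, ← EuclideanSpace.norm_sq_eq z, pow_succ ‖z‖ e]

section ShiftMap

variable {m d : ℕ} {η : ℂ} {z : Cn (m + 1)}

theorem shiftMap_apply_zero : shiftMap (m + 1) d η z 0 = η * z (Fin.last m) := rfl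

theorem shiftMap_apply_succ (i : Fin m) :
    shiftMap (m + 1) d η z i.succ = z i.succ ^ d + η * z i.castSucc := rfl

theorem differentiable_shiftMap : Differentiable ℂ (shiftMap (m + 1) d η) := by
  refine differentiable_euclidean.2 (Fin.cases ?_ fun i => ?_)
  · simp only [shiftMap_apply_zero]
    fun_prop
  · simp only [shiftMap_apply_succ]
    fun_prop

/-- For `η ≠ 0`, the inverse of the shift map: the equation `u = shiftMap (m + 1) d η z` is solved
for the coordinates of `z`, from the last to the first. -/
noncomputable def shiftInv (m d : ℕ) (η : ℂ) (u : Cn (m + 1)) : Cn (m + 1) :=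
  WithLp.toLp 2 (Fin.reverseInduction (u 0 / η) fun i x => (u i.succ - x ^ d) / η)

theorem shiftInv_apply_last (u : Cn (m + 1)) : shiftInv m d η u (Fin.last m) = u 0 / η :=
  Fin.reverseInduction_last ..

theorem shiftInv_apply_castSucc (u : Cn (m + 1)) (i : Fin m) :
    shiftInv m d η u i.castSucc = (u i.succ - shiftInv m d η u i.succ ^ d) / η :=
  Fin.reverseInduction_castSucc ..

theorem differentiable_shiftInv : Differentiable ℂ (shiftInv m d η) := by
  refine differentiable_euclidean.2 (Fin.reverseInduction ?_ fun i ih => ?_)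
  · simp only [shiftInv_apply_last]
    fun_prop
  · simp only [shiftInv_apply_castSucc]
    fun_prop

theorem leftInverse_shiftInv (hη : η ≠ 0) :
    Function.LeftInverse (shiftInv m d η) (shiftMap (m + 1) d η) := by
  intro z
  ext i
  induction i using Fin.reverseInduction with
  | last => rw [shiftInv_apply_last, shiftMap_apply_zero, mul_div_cancel_left₀ _ hη]
  | cast i ih =>
    rw [shiftInv_apply_castSucc, ih, shiftMap_apply_succ, add_sub_cancel_left,
      mul_div_cancel_left₀ _ hη]

theorem rightInverse_shiftInv (hη : η ≠ 0) :
    Function.RightInverse (shiftInv m d η) (shiftMap (m + 1) d η) := by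
  intro u
  ext i
  cases i using Fin.cases with
  | zero => rw [shiftMap_apply_zero, shiftInv_apply_last, mul_div_cancel₀ _ hη]
  | succ i =>
    rw [shiftMap_apply_succ, shiftInv_apply_castSucc, mul_div_cancel₀ _ hη, add_sub_cancel]

theorem isAutomorphism_shiftMap (hη : η ≠ 0) : IsAutomorphism (shiftMap (m + 1) d η) :=
  ⟨differentiable_shiftMap, shiftInv m d η, differentiable_shiftInv, leftInverse_shiftInv hη,
    rightInverse_shiftInv hη⟩

theorem norm_shiftMap_le (hd : d ≠ 0) (η : ℂ) (z : Cn (m + 1)) :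
    ‖shiftMap (m + 1) d η z‖ ≤ ‖z‖ ^ d + ‖η‖ * ‖z‖ := by
  set rot := LinearIsometryEquiv.piLpCongrLeft 2 ℂ ℂ (finRotate (m + 1))
  set powers : Cn (m + 1) := WithLp.toLp 2 (Fin.cons 0 fun i : Fin m => z i.succ ^ d)
  have hsum : shiftMap (m + 1) d η z = powers + η • rot z := by
    ext i
    cases i using Fin.cases with
    | zero =>
      have : (finRotate (m + 1)).symm 0 = Fin.last m := by
        rw [Equiv.symm_apply_eq, finRotate_last]
      simp [shiftMap_apply_zero, powers, rot, this]
    | succ i =>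
      have : (finRotate (m + 1)).symm i.succ = i.castSucc := by
        rw [Equiv.symm_apply_eq, finRotate_apply, Fin.coeSucc_eq_succ]
      simp [shiftMap_apply_succ, powers, rot, this]
  have hpowers : ‖powers‖ ≤ ‖z‖ ^ d := by
    refine norm_le_pow_of_forall_norm_le_pow hd (Fin.cases ?_ fun i => ?_)
    · simp [powers]
    · simp [powers]
  calc ‖shiftMap (m + 1) d η z‖ ≤ ‖powers‖ + ‖η‖ * ‖rot z‖ := by
        rw [hsum, ← norm_smul]
        exact norm_add_le _ _
    _ ≤ ‖z‖ ^ d + ‖η‖ * ‖z‖ := by rw [rot.norm_map]; gcongr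

theorem isSuperattracting_shiftMap (m : ℕ) {a : ℝ} {η : ℕ → ℂ} (hd : 2 ≤ d) (ha0 : 0 < a)
    (ha1 : a < 1) (hη : ∀ n, ‖η n‖ ≤ a ^ d ^ n) :
    IsSuperattracting (fun n => shiftMap (m + 1) d (η n)) d a where
  two_le := hd
  pos := ha0
  lt_one := ha1
  norm_le n z := (norm_shiftMap_le (by lia) (η n) z).trans (by gcongr; exact hη n)

/-- The points with a coordinate of maximal modulus, at least `2`, other than the first coordinate.
There the power in the shift map dominates the linear term, so orbits do not approach the origin. -/
def escapeRegion (m : ℕ) : Set (Cn (m + 1)) :=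
  {w | ∃ i : Fin m, 2 ≤ ‖w i.succ‖ ∧ ∀ j, ‖w j‖ ≤ ‖w i.succ‖}

theorem mapsTo_shiftMap_escapeRegion (hd : 2 ≤ d) (hη : ‖η‖ ≤ 1) :
    MapsTo (shiftMap (m + 1) d η) (escapeRegion m) (escapeRegion m) := by
  rintro w ⟨i, hi, hmax⟩
  set w' := shiftMap (m + 1) d η w
  have hmul : ∀ j, ‖η * w j‖ ≤ ‖w i.succ‖ := fun j => by
    rw [norm_mul]
    exact (mul_le_of_le_one_left (norm_nonneg _) hη).trans (hmax j)
  have hgrow : ‖w i.succ‖ ≤ ‖w' i.succ‖ :=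
    calc ‖w i.succ‖ ≤ ‖w i.succ‖ ^ 2 - ‖w i.succ‖ := by nlinarith
      _ ≤ ‖w i.succ‖ ^ d - ‖η * w i.castSucc‖ :=
        sub_le_sub (pow_le_pow_right₀ (by linarith) hd) (hmul _)
      _ ≤ ‖w' i.succ‖ := by
        rw [← norm_pow, shiftMap_apply_succ]
        exact norm_sub_le_norm_add _ _
  have : Nonempty (Fin m) := ⟨i⟩
  obtain ⟨i', hi'⟩ := Finite.exists_max fun j : Fin m => ‖w' j.succ‖
  refine ⟨i', hi.trans (hgrow.trans (hi' i)), Fin.cases ?_ hi'⟩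
  calc ‖w' 0‖ ≤ ‖w i.succ‖ := hmul (Fin.last m)
    _ ≤ ‖w' i'.succ‖ := hgrow.trans (hi' i)

theorem basin_shiftMap_ne_univ {η : ℕ → ℂ} (hm : m ≠ 0) (hd : 2 ≤ d) (hη : ∀ n, ‖η n‖ ≤ 1) :
    basin (fun n => shiftMap (m + 1) d (η n)) ≠ univ := by
  set i : Fin m := ⟨0, hm.bot_lt⟩
  have hz : EuclideanSpace.single i.succ 2 ∈ escapeRegion m := by
    refine ⟨i, by simp, fun j => ?_⟩
    simpa using PiLp.norm_apply_le (EuclideanSpace.single i.succ (2 : ℂ)) j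
  intro huniv
  have hlim : Tendsto (fun n => compUpTo (fun n => shiftMap (m + 1) d (η n)) n
      (EuclideanSpace.single i.succ 2)) atTop (𝓝 0) :=
    huniv.ge (mem_univ (EuclideanSpace.single i.succ 2))
  have hescape : ∀ n, 2 ≤ ‖compUpTo (fun n => shiftMap (m + 1) d (η n)) n
      (EuclideanSpace.single i.succ 2)‖ := fun n => by
    obtain ⟨j, hj, -⟩ :=
      compUpTo_mem_of_mapsTo (fun n => mapsTo_shiftMap_escapeRegion hd (hη n)) hz n
    exact hj.trans (PiLp.norm_apply_le _ _)
  have : (2 : ℝ) ≤ 0 := ge_of_tendsto' (by simpa using hlim.norm) hescape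
  norm_num at this

theorem two_mul_pow_le_norm_shiftMap_apply_succ {s : ℝ} (hd : 2 ≤ d) (hs : 0 ≤ s)
    (hη : ‖η‖ ≤ s ^ d) (hz : ‖z‖ ≤ 1) {i : Fin m} (hi : 2 * s ≤ ‖z i.succ‖) :
    2 * s ^ d ≤ ‖shiftMap (m + 1) d η z i.succ‖ := by
  have hpow : 4 * s ^ d ≤ ‖z i.succ ^ d‖ :=
    calc 4 * s ^ d = 2 ^ 2 * s ^ d := by ring
      _ ≤ 2 ^ d * s ^ d := by gcongr; exact one_le_two
      _ = (2 * s) ^ d := (mul_pow _ _ _).symm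
      _ ≤ ‖z i.succ ^ d‖ := by rw [norm_pow]; gcongr
  have hlin : ‖η * z i.castSucc‖ ≤ s ^ d := by
    rw [norm_mul]
    exact (mul_le_of_le_one_right (norm_nonneg η) ((PiLp.norm_apply_le z _).trans hz)).trans hη
  rw [shiftMap_apply_succ]
  linarith [norm_sub_le_norm_add (z i.succ ^ d) (η * z i.castSucc), pow_nonneg hs d]

theorem two_mul_pow_le_norm_compUpTo_apply_succ {η : ℕ → ℂ} {c : ℝ} {N : ℕ} (hd : 2 ≤ d)
    (hc : 0 ≤ c) (hη : ∀ n, ‖η n‖ ≤ c ^ d ^ n)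
    (hz : ∀ j, ‖compUpTo (fun n => shiftMap (m + 1) d (η n)) (N + j) z‖ ≤ 1) {i : Fin m}
    (hi : 2 * c ^ d ^ N ≤ ‖compUpTo (fun n => shiftMap (m + 1) d (η n)) N z i.succ‖) :
    ∀ j, 2 * c ^ d ^ (N + j) ≤
      ‖compUpTo (fun n => shiftMap (m + 1) d (η n)) (N + j) z i.succ‖
  | 0 => hi
  | j + 1 => by
    have ih := two_mul_pow_le_norm_compUpTo_apply_succ hd hc hη hz hi j
    have hsucc : c ^ d ^ (N + (j + 1)) = (c ^ d ^ (N + j)) ^ d := by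
      rw [← add_assoc, pow_succ d, pow_mul]
    rw [hsucc]
    exact two_mul_pow_le_norm_shiftMap_apply_succ hd (by positivity) (hsucc ▸ hη _) (hz j) ih

theorem exists_mem_basin_log_le_potential {η : ℕ → ℂ} {a c : ℝ} (hm : m ≠ 0) (hd : 2 ≤ d)
    (ha0 : 0 < a) (hη0 : ∀ n, η n ≠ 0) (hη : ∀ n, ‖η n‖ ≤ a ^ d ^ n) (hac : a ≤ c) (hc : c < 1) :
    ∃ w ∈ basin (fun n => shiftMap (m + 1) d (η n)),
      log c ≤ potential (fun n => shiftMap (m + 1) d (η n)) d a w := by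
  set F : ℕ → Cn (m + 1) → Cn (m + 1) := fun n => shiftMap (m + 1) d (η n)
  have hF : IsSuperattracting F d a := isSuperattracting_shiftMap m hd ha0 (hac.trans_lt hc) hη
  have hc0 : 0 < c := ha0.trans_le hac
  have hsmall : ∀ᶠ n in atTop, c ^ d ^ n < 1 / 8 :=
    (tendsto_pow_pow_atTop hc0.le hc hd).eventually_lt_const (by norm_num)
  obtain ⟨N, hN, hcN⟩ := (hF.eventually_eventuallyContracting.and hsmall).exists
  set i : Fin m := ⟨0, hm.bot_lt⟩
  obtain ⟨w, hw⟩ : ∃ w, compUpTo F N w = EuclideanSpace.single i.succ ((2 * c ^ d ^ N : ℝ) : ℂ) :=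
    (IsAutomorphism.compUpTo (fun n => isAutomorphism_shiftMap (hη0 n)) N).surjective _
  have hwN : ‖compUpTo F N w‖ < 1 / 4 := by
    rw [hw, PiLp.norm_single, Complex.norm_real, norm_of_nonneg (by positivity)]
    linarith
  have hle : ∀ j, ‖compUpTo F (N + j) w‖ ≤ 1 := fun j =>
    calc ‖compUpTo F (N + j) w‖ ≤ (1 / 2) ^ j * ‖compUpTo F N w‖ :=
          hN.norm_compUpTo_add_le le_rfl hwN j
      _ ≤ 1 * 1 := by gcongr; exacts [pow_le_one₀ (by norm_num) (by norm_num), by linarith]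
      _ = 1 := one_mul 1
  have hlow : ∀ j, 2 * c ^ d ^ (N + j) ≤ ‖compUpTo F (N + j) w i.succ‖ :=
    two_mul_pow_le_norm_compUpTo_apply_succ hd hc0.le
      (fun n => (hη n).trans (pow_le_pow_left₀ ha0.le hac _)) hle
      (by rw [hw]; simp [abs_of_pos hc0])
  refine ⟨w, hN.basin_eq_iUnion ▸ mem_iUnion.2 ⟨0, by simpa using hwN⟩,
    hF.log_le_potential_of_eventually_pow_le hc0 (eventually_atTop.2 ⟨N, fun n hn => ?_⟩)⟩
  obtain ⟨j, rfl⟩ := Nat.exists_eq_add_of_le hn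
  calc c ^ d ^ (N + j) ≤ 2 * c ^ d ^ (N + j) := le_mul_of_one_le_left (by positivity) one_le_two
    _ ≤ ‖compUpTo F (N + j) w i.succ‖ := hlow j
    _ ≤ ‖compUpTo F (N + j) w‖ := PiLp.norm_apply_le _ _

theorem exists_mem_basin_log_lt_potential {η : ℕ → ℂ} {a : ℝ} (hm : m ≠ 0) (hd : 2 ≤ d)
    (ha0 : 0 < a) (ha1 : a < 1) (hη0 : ∀ n, η n ≠ 0) (hη : ∀ n, ‖η n‖ ≤ a ^ d ^ n) :
    ∃ w ∈ basin (fun n => shiftMap (m + 1) d (η n)),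
      log a < potential (fun n => shiftMap (m + 1) d (η n)) d a w := by
  obtain ⟨c, hac, hc⟩ := exists_between ha1
  obtain ⟨w, hw, hcw⟩ := exists_mem_basin_log_le_potential hm hd ha0 hη0 hη hac.le hc
  exact ⟨w, hw, (log_lt_log ha0 hac).trans_le hcw⟩

end ShiftMap

end ShortCk

open ShortCk in
theorem theorem3p1 (k d : ℕ) (hk : 2 ≤ k) (hd : 2 ≤ d) (a : ℝ) (ha0 : 0 < a) (ha1 : a < 1)
    (η : ℕ → ℂ) (hη0 : ∀ n, η n ≠ 0) (hη : ∀ n, ‖η n‖ ≤ a ^ (d ^ n))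
    (Ω : Set (ShortCk.Cn k)) (hΩ : Ω = ShortCk.basin (fun n => ShortCk.shiftMap k d (η n))) :
    (Ω.Nonempty ∧ IsOpen Ω ∧ IsConnected Ω) ∧
    ShortCk.IsIncreasingUnionOfBalls Ω ∧
    (∀ p ∈ Ω, ∀ ξ : ShortCk.Cn k, ShortCk.kobayashiMetric Ω p ξ = 0) ∧
    (∃ ψ : ShortCk.Cn k → ℝ, ShortCk.IsPSHOn ψ Set.univ ∧ (∀ z, Real.log a ≤ ψ z) ∧
      Ω = {z | ψ z < 0} ∧ ∃ z ∈ Ω, ∃ w ∈ Ω, ψ z ≠ ψ w) ∧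
    ShortCk.IsShortCk Ω := by
  subst hΩ
  obtain ⟨m, rfl⟩ := Nat.exists_eq_add_of_le' hk
  set F : ℕ → Cn (m + 2) → Cn (m + 2) := fun n => shiftMap (m + 2) d (η n)
  have hauto : ∀ n, IsAutomorphism (F n) := fun n => isAutomorphism_shiftMap (hη0 n)
  have hF : IsSuperattracting F d a := isSuperattracting_shiftMap (m + 1) hd ha0 ha1 hη
  obtain ⟨N, hN⟩ := hF.eventually_eventuallyContracting.exists
  have hopen := hN.isOpen_basin hauto
  have hconn := hN.isConnected_basin hauto
  have hballs := hN.isIncreasingUnionOfBalls_basin hauto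
  have hkob : ∀ p ∈ basin F, ∀ ξ, kobayashiMetric (basin F) p ξ = 0 := fun _ hp =>
    hN.kobayashiMetric_basin hauto hp
  have hpsh := hF.isPSHOn_potential hauto
  have hbasin := hF.basin_eq_setOf_potential_neg
  have hnonconst : ∃ z ∈ basin F, ∃ w ∈ basin F, potential F d a z ≠ potential F d a w := by
    obtain ⟨w, hw, haw⟩ :=
      exists_mem_basin_log_lt_potential m.succ_ne_zero hd ha0 ha1 hη0 hη
    exact ⟨0, hF.zero_mem_basin, w, hw, (hF.potential_zero.trans_lt haw).ne⟩
  have hne : basin F ≠ Set.univ := basin_shiftMap_ne_univ m.succ_ne_zero hd fun n =>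
    (hη n).trans (pow_le_one₀ ha0.le ha1.le)
  exact ⟨⟨hconn.nonempty, hopen, hconn⟩, hballs, hkob,
    ⟨potential F d a, hpsh, hF.log_le_potential, hbasin, hnonconst⟩,
    hopen, hconn, hne, hballs, hkob, potential F d a, hpsh.mono (Set.subset_univ _),
    ⟨Real.log a, 0, fun z hz => ⟨hF.log_le_potential z, (hbasin.le hz).le⟩⟩, hnonconst⟩
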